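/- All graphs are finite and simple. For positive integers $n,d$ with $n\ge 2d$, let $K_{n/d}$ be the graph on $\{0,1,\dots,n-1\}$ in which $i$ and $j$ are adjacent if and only if $d\le|i-j|\le n-d$, and let $$\chi_c(G)=\inf\{\,n/d : n\ge 2d\ge 2 \text{ and there is a graph homomorphism } G\to K_{n/d}\,\}$$ be the circular chromatic number of $G$. For a graph $G$ and positive integers $p,q$, let $G^{1/q}$ be the graph obtained from $G$ by replacing every edge by a path with $q$ edges, let $G^{p}$ be the graph on $V(G)$ in which two distinct vertices are adjacent if and only if they are joined by a walk of length exactly $p$ in $G$, and let $G^{p/q}=(G^{1/q})^{p}$. Let $r,s$ be non-negative integers and let $G$ be a non-bipartite graph. If $$\frac{2r+1}{2s+1}\le\frac{\chi_c(G)}{3(\chi_c(G)-2)},$$ then $$\chi_c\bigl(G^{(2r+1)/(2s+1)}\bigr)=\frac{(2s+1)\,\chi_c(G)}{(s-r)\,\chi_c(G)+2r+1}.$$ -/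

import Mathlib

namespace FracPow

/-- The circular complete graph `K_{n/d}` on `{0, …, n-1}`: `i` and `j` are adjacent iff
`d ≤ |i - j| ≤ n - d`. (The condition `i ≠ j` is automatic as soon as `d` is positive, which
is the only case used.) -/
def circularComplete (n d : ℕ) : SimpleGraph (Fin n) where
  Adj i j := i ≠ j ∧ (d : ℤ) ≤ |(i : ℤ) - (j : ℤ)| ∧ |(i : ℤ) - (j : ℤ)| ≤ (n : ℤ) - (d : ℤ)
  symm := ⟨fun i j h => ⟨h.1.symm, by rw [abs_sub_comm]; exact h.2⟩⟩
  loopless := ⟨fun _ h => h.1 rfl⟩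

/-- The circular chromatic number: the infimum of `n / d` over all positive integers `n, d` with
`2d ≤ n` such that `G` has a homomorphism to `K_{n/d}`. -/
noncomputable def circularChromaticNumber {V : Type*} (G : SimpleGraph V) : ℝ :=
  sInf {x : ℝ | ∃ n d : ℕ, 0 < d ∧ 2 * d ≤ n ∧
    Nonempty (G →g circularComplete n d) ∧ x = (n : ℝ) / (d : ℝ)}

/-- The `k`th power of `G`: two distinct vertices are adjacent iff they are joined by a walk of
length exactly `k` in `G`. -/
def power {V : Type*} (G : SimpleGraph V) (k : ℕ) : SimpleGraph V where
  Adj u v := u ≠ v ∧ ∃ p : G.Walk u v, p.length = k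
  symm := ⟨fun _ _ h => ⟨h.1.symm, h.2.elim fun p hp => ⟨p.reverse, by simpa using hp⟩⟩⟩
  loopless := ⟨fun _ h => h.1 rfl⟩

/-- The vertices of the `s`-subdivision: the vertices of `G`, and `s - 1` new vertices for
every edge of `G`. -/
abbrev SubdivVertex {V : Type*} (G : SimpleGraph V) (s : ℕ) : Type _ :=
  V ⊕ (G.edgeSet × Fin (s - 1))

/-- The `i`th vertex (`0 ≤ i ≤ s`) of the path with `s` edges that replaces the edge `e`. The path
runs from one endpoint of `e` to the other, in an arbitrarily chosen direction. -/
noncomputable def pathVertex {V : Type*} (G : SimpleGraph V) (s : ℕ) (e : G.edgeSet) (i : ℕ) :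
    SubdivVertex G s :=
  if h0 : i = 0 then Sum.inl (Quot.out e.1).1
  else if h : i < s then Sum.inr (e, ⟨i - 1, by omega⟩)
  else Sum.inl (Quot.out e.1).2

/-- The graph `G^{1/s}` (for `s ≥ 1`): every edge of `G` is replaced by a path with `s` edges. -/
noncomputable def subdivision {V : Type*} (G : SimpleGraph V) (s : ℕ) :
    SimpleGraph (SubdivVertex G s) :=
  SimpleGraph.fromRel fun x y =>
    ∃ (e : G.edgeSet) (i : ℕ), i < s ∧ x = pathVertex G s e i ∧ y = pathVertex G s e (i + 1)

/-- The fractional power `G^{r/s} = (G^{1/s})^r`. -/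
noncomputable def fracPower {V : Type*} (G : SimpleGraph V) (r s : ℕ) :
    SimpleGraph (SubdivVertex G s) :=
  power (subdivision G s) r

end FracPow

/-!
Place the vertices on the circle `ℝ / ℤ` so that adjacent vertices are antipodal up to an error
`δ`. The infimum of the possible `δ` is `1 / 2 - 1 / χ_c(G)`, so it suffices to show that passing
to `G^{p/q}` with `p`, `q` odd multiplies this infimum by `p / q`. Subdividing an edge spreads its
error evenly over `q` edges, and walks of length `p` accumulate at most `p` errors. The only
nontrivial point is to recover, from a placement with error `ε < 1 / 4` of the `p`th power of a
graph `H`, a placement of `H` with error `ε / p`. Lift the errors of the edges of `H` to `ℝ`. Since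
`4ε < 1`, the lifted errors cannot wind around the circle, so their sum along every walk of length
`p` is at most `ε`. Let `S j v` be the largest sum along a walk of length `j` from `v`; then moving
each `v` by the average of `S 0 v, …, S (p - 1) v` leaves on every edge only a telescoping sum,
divided by `p`.
-/

namespace FracPow

open SimpleGraph

section Circle

theorem exists_coe_eq_and_abs_eq_norm (x : UnitAddCircle) :
    ∃ t : ℝ, (t : UnitAddCircle) = x ∧ |t| = ‖x‖ := by
  obtain ⟨t, rfl⟩ := QuotientAddGroup.mk_surjective x
  refine ⟨t - round t, ?_, UnitAddCircle.norm_eq.symm⟩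
  rw [AddCircle.coe_sub, sub_eq_self, AddCircle.coe_eq_zero_iff]
  exact ⟨round t, by simp⟩

theorem eq_of_coe_eq_coe_of_abs_sub_lt_one {s t : ℝ} (h : (s : UnitAddCircle) = t)
    (hst : |s - t| < 1) : s = t := by
  rw [← sub_eq_zero, ← AddCircle.coe_sub, AddCircle.coe_eq_zero_iff] at h
  obtain ⟨k, hk⟩ := h
  rw [zsmul_one] at hk
  have hk0 : k = 0 := Int.abs_lt_one_iff.1 (by rw [← hk] at hst; exact_mod_cast hst)
  rw [hk0, Int.cast_zero] at hk
  exact sub_eq_zero.1 hk.symm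

theorem norm_coe_eq_min {t : ℝ} (ht : |t| < 1) : ‖(t : UnitAddCircle)‖ = min |t| (1 - |t|) := by
  wlog h0 : 0 ≤ t generalizing t
  · have := this (t := -t) (by rwa [abs_neg]) (by linarith)
    rwa [AddCircle.coe_neg, norm_neg, abs_neg] at this
  rw [abs_of_nonneg h0] at ht ⊢
  rw [UnitAddCircle.norm_eq, abs_sub_round_eq_min, Int.fract_eq_self.2 ⟨h0, ht⟩]

/-- The half turn of the circle `ℝ / ℤ`: two points are antipodal iff they differ by it. -/
noncomputable def halfTurn : UnitAddCircle := ((1 / 2 : ℝ) : UnitAddCircle)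

theorem halfTurn_add_halfTurn : halfTurn + halfTurn = 0 := by
  rw [halfTurn, ← AddCircle.coe_add, add_halves, AddCircle.coe_period]

theorem neg_halfTurn : -halfTurn = halfTurn :=
  neg_eq_of_add_eq_zero_left halfTurn_add_halfTurn

theorem nsmul_halfTurn_of_odd {n : ℕ} (hn : Odd n) : n • halfTurn = halfTurn := by
  obtain ⟨k, rfl⟩ := hn
  rw [add_nsmul, mul_comm, mul_nsmul, two_nsmul, ← nsmul_add, halfTurn_add_halfTurn, nsmul_zero,
    zero_add, one_nsmul]

theorem norm_halfTurn : ‖halfTurn‖ = 1 / 2 := by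
  simpa [halfTurn] using AddCircle.norm_half_period_eq (1 : ℝ)

theorem norm_sub_halfTurn (x : UnitAddCircle) : ‖x - halfTurn‖ = 1 / 2 - ‖x‖ := by
  obtain ⟨t, rfl, ht⟩ := exists_coe_eq_and_abs_eq_norm x
  have hle : |t| ≤ 1 / 2 := by
    rw [ht]; simpa using AddCircle.norm_le_half_period (1 : ℝ) (x := t) one_ne_zero
  wlog h0 : 0 ≤ t generalizing t
  · have := this (-t) (by rw [abs_neg, AddCircle.coe_neg, norm_neg, ht]) (by rwa [abs_neg])
      (by linarith)
    rwa [AddCircle.coe_neg, ← norm_neg, neg_sub, sub_neg_eq_add, add_comm,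
      ← sub_neg_eq_add, neg_halfTurn, norm_neg] at this
  rw [← ht, halfTurn, ← AddCircle.coe_sub, abs_of_nonneg h0]
  rw [abs_of_nonneg h0] at hle
  have habs : |t - 1 / 2| = 1 / 2 - t := by rw [abs_of_nonpos (by linarith), neg_sub]
  rw [← habs]
  exact (AddCircle.norm_coe_eq_abs_iff 1 one_ne_zero).2 (by rw [habs, abs_one]; linarith)

theorem norm_sub_sub_halfTurn_comm (x y : UnitAddCircle) :
    ‖x - y - halfTurn‖ = ‖y - x - halfTurn‖ := by
  rw [norm_sub_halfTurn, norm_sub_halfTurn, norm_sub_rev]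

end Circle

section AntipodalColoring

variable {V : Type*} {G : SimpleGraph V} {φ : V → UnitAddCircle} {δ ε : ℝ}

/-- `φ` places the vertices of `G` on the circle `ℝ / ℤ` in such a way that adjacent vertices are
antipodal up to an error of at most `δ`. -/
def IsAntipodalColoring (G : SimpleGraph V) (δ : ℝ) (φ : V → UnitAddCircle) : Prop :=
  ∀ ⦃u v⦄, G.Adj u v → ‖φ v - φ u - halfTurn‖ ≤ δ

/-- `G` has an antipodal colouring with error at most `δ`. By `norm_sub_halfTurn`, this is a
circular `r`-colouring in the usual sense for `1 / r = 1 / 2 - δ`. -/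
def AntipodalColorable (G : SimpleGraph V) (δ : ℝ) : Prop :=
  ∃ φ : V → UnitAddCircle, IsAntipodalColoring G δ φ

theorem AntipodalColorable.mono (h : AntipodalColorable G δ) (hδ : δ ≤ ε) :
    AntipodalColorable G ε :=
  h.imp fun _ hφ _ _ huv => (hφ huv).trans hδ

theorem antipodalColorable_half (G : SimpleGraph V) : AntipodalColorable G (1 / 2) :=
  ⟨fun _ => 0, fun _ _ _ => by rw [sub_zero, zero_sub, norm_neg, norm_halfTurn]⟩

theorem IsAntipodalColoring.norm_sub_sub_nsmul_le (hφ : IsAntipodalColoring G δ φ) {u v : V}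
    (p : G.Walk u v) : ‖φ v - φ u - p.length • halfTurn‖ ≤ p.length * δ := by
  induction p with
  | nil => simp
  | @cons u v w h p ih =>
    calc ‖φ w - φ u - (p.length + 1) • halfTurn‖
        = ‖(φ w - φ v - p.length • halfTurn) + (φ v - φ u - halfTurn)‖ := by
          congr 1; rw [succ_nsmul]; abel
      _ ≤ p.length * δ + δ := norm_add_le_of_le ih (hφ h)
      _ = (p.length + 1 : ℕ) * δ := by push_cast; ring

theorem IsAntipodalColoring.norm_sub_sub_le_of_odd (hφ : IsAntipodalColoring G δ φ) {u v : V}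
    (p : G.Walk u v) (hp : Odd p.length) : ‖φ v - φ u - halfTurn‖ ≤ p.length * δ := by
  simpa only [nsmul_halfTurn_of_odd hp] using hφ.norm_sub_sub_nsmul_le p

theorem AntipodalColorable.half_le_length_mul (h : AntipodalColorable G δ) {u : V}
    (p : G.Walk u u) (hp : Odd p.length) : 1 / 2 ≤ p.length * δ := by
  obtain ⟨φ, hφ⟩ := h
  simpa only [sub_self, zero_sub, norm_neg, norm_halfTurn] using hφ.norm_sub_sub_le_of_odd p hp

theorem AntipodalColorable.power (h : AntipodalColorable G δ) {k : ℕ} (hk : Odd k) :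
    AntipodalColorable (power G k) (k * δ) := by
  obtain ⟨φ, hφ⟩ := h
  refine ⟨φ, ?_⟩
  rintro u v ⟨-, p, rfl⟩
  exact hφ.norm_sub_sub_le_of_odd p hk

end AntipodalColoring

section CircularChromaticNumber

variable {V : Type*} {G : SimpleGraph V} {δ : ℝ} {n d : ℕ}

theorem circularComplete_adj_iff (hd : 0 < d) {i j : Fin n} :
    (circularComplete n d).Adj i j ↔
      (d : ℝ) / n ≤ ‖(((j : ℝ) / n : ℝ) : UnitAddCircle) - ((i : ℝ) / n : ℝ)‖ := by
  have hn : (0 : ℝ) < n := by exact_mod_cast i.pos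
  have habs : |(j : ℝ) / n - (i : ℝ) / n| = |(i : ℝ) - j| / n := by
    rw [← sub_div, abs_div, abs_of_pos hn, abs_sub_comm]
  have hlt : |(i : ℝ) - j| < n := by
    have hi : (i : ℝ) < n := by exact_mod_cast i.2
    have hj : (j : ℝ) < n := by exact_mod_cast j.2
    rw [abs_lt]
    constructor <;> linarith [(i : ℕ).cast_nonneg (α := ℝ), (j : ℕ).cast_nonneg (α := ℝ)]
  rw [← AddCircle.coe_sub, norm_coe_eq_min (by rwa [habs, div_lt_one hn]), habs, le_min_iff,
    div_le_div_iff_of_pos_right hn, le_sub_iff_add_le, ← add_div, div_le_one hn]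
  have hadj : (circularComplete n d).Adj i j ↔
      (d : ℤ) ≤ |(i : ℤ) - j| ∧ (d : ℤ) + |(i : ℤ) - j| ≤ n := by
    refine ⟨fun h => ⟨h.2.1, by linarith [h.2.2]⟩, fun h => ⟨?_, h.1, by linarith [h.2]⟩⟩
    rintro rfl
    rw [sub_self, abs_zero] at h
    omega
  rw [hadj]
  exact_mod_cast Iff.rfl

theorem circularComplete_one (n : ℕ) : circularComplete n 1 = ⊤ := by
  ext i j
  rw [top_adj]
  refine ⟨fun h => h.1, fun h => ⟨h, ?_, ?_⟩⟩
  · rw [Nat.cast_one]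
    exact Int.one_le_abs (sub_ne_zero.2 (Nat.cast_injective.ne (Fin.val_ne_of_ne h)))
  · rw [abs_le]; omega

theorem antipodalColorable_of_hom (hd : 0 < d) (f : G →g circularComplete n d) :
    AntipodalColorable G (1 / 2 - (d : ℝ) / n) := by
  refine ⟨fun v => ((f v : ℝ) / n : ℝ), fun u v huv => ?_⟩
  rw [norm_sub_halfTurn]
  exact sub_le_sub_left ((circularComplete_adj_iff hd).1 (f.map_rel huv)) _

theorem AntipodalColorable.nonempty_hom (h : AntipodalColorable G δ) (hd : 0 < d)
    (hdn : d + 1 ≤ n * (1 / 2 - δ)) : Nonempty (G →g circularComplete n d) := by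
  obtain ⟨φ, hφ⟩ := h
  have hn : (0 : ℝ) < n := by
    refine n.cast_nonneg.lt_of_ne fun hn0 => ?_
    rw [← hn0, zero_mul] at hdn
    linarith [d.cast_nonneg (α := ℝ)]
  let x : V → ℝ := fun v => AddCircle.equivIco 1 0 (φ v)
  have hx : ∀ v, 0 ≤ n * x v ∧ n * x v < n := fun v => by
    obtain ⟨h0, h1⟩ := (AddCircle.equivIco 1 0 (φ v)).2
    exact ⟨mul_nonneg hn.le h0, mul_lt_of_lt_one_right hn (h1.trans_eq (zero_add 1))⟩
  let i : V → Fin n := fun v => ⟨⌊n * x v⌋₊, (Nat.floor_lt (hx v).1).2 (hx v).2⟩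
  refine ⟨⟨i, fun {u v} huv => (circularComplete_adj_iff hd).2 ?_⟩⟩
  -- Rounding down to multiples of `1 / n` costs less than `1 / n`, paid for by the `+ 1` in `hdn`.
  let e : V → ℝ := fun v => x v - (i v : ℝ) / n
  have he : ∀ v, 0 ≤ e v ∧ e v ≤ 1 / n := fun v => by
    have hle : (i v : ℝ) ≤ n * x v := Nat.floor_le (hx v).1
    have hlt : n * x v < (i v : ℝ) + 1 := Nat.lt_floor_add_one _
    rw [sub_nonneg, div_le_iff₀ hn, sub_le_iff_le_add, ← add_div, le_div_iff₀ hn]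
    constructor <;> linarith
  have hround : ‖((e v - e u : ℝ) : UnitAddCircle)‖ ≤ 1 / n :=
    QuotientAddGroup.norm_mk_le_norm.trans <|
      abs_le.2 ⟨by linarith [he u, he v], by linarith [he u, he v]⟩
  have hsplit : φ v - φ u =
      ((((i v : ℝ) / n : ℝ) : UnitAddCircle) - ((i u : ℝ) / n : ℝ)) + (e v - e u : ℝ) := by
    have hcoe : ∀ w, (x w : UnitAddCircle) = φ w := fun w => AddCircle.coe_equivIco
    simp only [e, AddCircle.coe_sub, hcoe]
    abel
  have hfar : 1 / 2 - δ ≤ ‖φ v - φ u‖ := by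
    have := hφ huv
    rw [norm_sub_halfTurn] at this
    linarith
  have hdn' : (d : ℝ) / n + 1 / n ≤ 1 / 2 - δ := by
    rwa [← add_div, div_le_iff₀ hn, mul_comm]
  rw [hsplit] at hfar
  linarith [hfar.trans (norm_add_le _ _)]

theorem circularChromaticNumber_le_div (hd : 0 < d) (hn : 2 * d ≤ n)
    (f : G →g circularComplete n d) : circularChromaticNumber G ≤ n / d :=
  csInf_le ⟨0, by rintro _ ⟨n, d, -, -, -, rfl⟩; positivity⟩ ⟨n, d, hd, hn, ⟨f⟩, rfl⟩

theorem two_le_circularChromaticNumber_of_hom (hd : 0 < d) (hn : 2 * d ≤ n)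
    (f : G →g circularComplete n d) : 2 ≤ circularChromaticNumber G := by
  refine le_csInf ⟨_, n, d, hd, hn, ⟨f⟩, rfl⟩ ?_
  rintro _ ⟨n, d, hd, hn, -, rfl⟩
  rw [le_div_iff₀ (by exact_mod_cast hd)]
  exact_mod_cast hn

theorem two_le_circularChromaticNumber (hG : G.Colorable n) : 2 ≤ circularChromaticNumber G := by
  obtain ⟨f⟩ : Nonempty (G →g circularComplete (n + 2) 1) := by
    rw [circularComplete_one]
    exact hG.mono (Nat.le_add_right n 2)
  exact two_le_circularChromaticNumber_of_hom one_pos (by omega) f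

theorem exists_hom_of_lt {t : ℝ} (ht : 0 < t) (h : t < 1 / circularChromaticNumber G) :
    ∃ n d : ℕ, 0 < d ∧ 2 * d ≤ n ∧ t < d / n ∧ Nonempty (G →g circularComplete n d) := by
  have hne : {x : ℝ | ∃ n d : ℕ, 0 < d ∧ 2 * d ≤ n ∧
      Nonempty (G →g circularComplete n d) ∧ x = (n : ℝ) / (d : ℝ)}.Nonempty := by
    by_contra hempty
    rw [Set.not_nonempty_iff_eq_empty] at hempty
    rw [circularChromaticNumber, hempty, Real.sInf_empty, div_zero] at h
    exact ht.not_gt h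
  have hlt : circularChromaticNumber G < 1 / t :=
    (lt_one_div ht (one_div_pos.1 (ht.trans h))).1 h
  obtain ⟨_, ⟨n, d, hd, hn, hf, rfl⟩, hx⟩ := exists_lt_of_csInf_lt hne hlt
  have hd' : (0 : ℝ) < d := by exact_mod_cast hd
  have hn' : (0 : ℝ) < n := by exact_mod_cast (show 0 < n by omega)
  refine ⟨n, d, hd, hn, ?_, hf⟩
  rwa [lt_one_div (div_pos hn' hd') ht, one_div_div] at hx

theorem one_div_circularChromaticNumber_le_half (G : SimpleGraph V) :
    1 / circularChromaticNumber G ≤ 1 / 2 := by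
  by_contra! hlt
  obtain ⟨n, d, hd, hn, hdn, -⟩ := exists_hom_of_lt one_half_pos hlt
  have hn' : (0 : ℝ) < n := by exact_mod_cast (show 0 < n by omega)
  rw [div_lt_div_iff₀ two_pos hn', one_mul, mul_comm] at hdn
  exact hn.not_gt (by exact_mod_cast hdn)

/-- For a graph without finite colourings the hypothesis reads `1 / 2 < δ`, because then
`circularChromaticNumber G = sInf ∅ = 0` and `1 / 0 = 0`. -/
theorem antipodalColorable_of_lt (hδ : 1 / 2 - 1 / circularChromaticNumber G < δ) :
    AntipodalColorable G δ := by
  rcases le_or_gt (1 / 2) δ with hhalf | hhalf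
  · exact (antipodalColorable_half G).mono hhalf
  · obtain ⟨n, d, hd, -, hlt, ⟨f⟩⟩ :=
      exists_hom_of_lt (G := G) (t := 1 / 2 - δ) (by linarith) (by linarith)
    exact (antipodalColorable_of_hom hd f).mono (by linarith)

theorem exists_nat_mul_lt_and_add_one_le_mul {y t : ℝ} (hy : 0 ≤ y) (hyt : y < t) :
    ∃ n d : ℕ, 0 < d ∧ n * y < d ∧ d + 1 ≤ n * t := by
  obtain ⟨n, hn⟩ := exists_nat_gt (2 / (t - y))
  rw [div_lt_iff₀ (sub_pos.2 hyt), mul_sub] at hn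
  have hny : 0 ≤ n * y := by positivity
  have hfloor : 2 ≤ ⌊n * t⌋₊ := Nat.le_floor (by push_cast; linarith)
  refine ⟨n, ⌊n * t⌋₊ - 1, by omega, ?_, ?_⟩ <;>
    rw [Nat.cast_sub (by omega), Nat.cast_one]
  · linarith [Nat.lt_floor_add_one (n * t)]
  · rw [sub_add_cancel]
    exact Nat.floor_le (by linarith)

theorem AntipodalColorable.half_sub_one_div_le (h : AntipodalColorable G δ) (hδ : 0 ≤ δ) :
    1 / 2 - 1 / circularChromaticNumber G ≤ δ := by
  by_contra! hlt
  have hχ : 0 ≤ 1 / circularChromaticNumber G := by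
    refine one_div_nonneg.2 (Real.sInf_nonneg ?_)
    rintro _ ⟨n, d, -, -, -, rfl⟩
    positivity
  obtain ⟨n, d, hd, hnd, hdn⟩ :=
    exists_nat_mul_lt_and_add_one_le_mul hχ (show _ < 1 / 2 - δ by linarith)
  obtain ⟨f⟩ := h.nonempty_hom hd hdn
  have hn : 2 * d ≤ n := by
    have : (2 * d : ℝ) ≤ n := by nlinarith [n.cast_nonneg (α := ℝ)]
    exact_mod_cast this
  have hχ2 := two_le_circularChromaticNumber_of_hom hd hn f
  have hle := circularChromaticNumber_le_div hd hn f
  rw [le_div_iff₀ (by exact_mod_cast hd)] at hle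
  rw [mul_one_div, div_lt_iff₀ (by linarith)] at hnd
  linarith

end CircularChromaticNumber

section Walks

variable {V : Type*} {H : SimpleGraph V}

theorem exists_walk_length_add_two_mul {u v : V} (p : H.Walk u v) (hp : ¬p.Nil) (j : ℕ) :
    ∃ q : H.Walk u v, q.length = p.length + 2 * j := by
  cases p with
  | nil => simp at hp
  | cons h p =>
    induction j with
    | zero => exact ⟨.cons h p, rfl⟩
    | succ j ih =>
      obtain ⟨q, hq⟩ := ih
      exact ⟨.cons h (.cons h.symm q), by simp only [Walk.length_cons, hq]; ring⟩

theorem exists_walk_length_eq_of_odd {u v : V} (p : H.Walk u v) (hp : Odd p.length) {n : ℕ}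
    (hn : Odd n) (hpn : p.length ≤ n) : ∃ q : H.Walk u v, q.length = n := by
  obtain ⟨j, hj⟩ := Nat.Odd.sub_odd hn hp
  obtain ⟨q, hq⟩ := exists_walk_length_add_two_mul p (by
    rw [← Walk.length_eq_zero_iff]; exact hp.pos.ne') j
  exact ⟨q, by omega⟩

theorem exists_walk_length_eq_of_adj {u v : V} (h : H.Adj u v) (n : ℕ) :
    ∃ (w : V) (p : H.Walk u w), p.length = n := by
  induction n generalizing u v with
  | zero => exact ⟨u, .nil, rfl⟩
  | succ n ih =>
    obtain ⟨w, p, rfl⟩ := ih h.symm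
    exact ⟨w, .cons h p, rfl⟩

/-- The sum of the edge weights `w` along a walk; an edge traversed from `u` to `v` weighs
`w u v`. -/
def walkSum (w : V → V → ℝ) {u v : V} (p : H.Walk u v) : ℝ :=
  (p.darts.map fun d => w d.fst d.snd).sum

theorem walkSum_nil (w : V → V → ℝ) (u : V) : walkSum w (.nil : H.Walk u u) = 0 :=
  rfl

theorem walkSum_cons (w : V → V → ℝ) {u v x : V} (h : H.Adj u v) (p : H.Walk v x) :
    walkSum w (.cons h p) = w u v + walkSum w p := by
  simp [walkSum]

theorem walkSum_le_length_mul {w : V → V → ℝ} {C : ℝ} (hC : ∀ ⦃u v⦄, H.Adj u v → w u v ≤ C)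
    {u v : V} (p : H.Walk u v) : walkSum w p ≤ p.length * C := by
  induction p with
  | nil => simp [walkSum_nil]
  | cons h p ih =>
    rw [walkSum_cons, Walk.length_cons]
    push_cast
    linarith [hC h]

theorem coe_walkSum {w : V → V → ℝ} {ψ : V → UnitAddCircle}
    (hw : ∀ u v, (w u v : UnitAddCircle) = ψ v - ψ u - halfTurn) {u v : V} (p : H.Walk u v) :
    (walkSum w p : UnitAddCircle) = ψ v - ψ u - p.length • halfTurn := by
  induction p with
  | nil => simp [walkSum_nil]
  | cons h p ih =>
    rw [walkSum_cons, AddCircle.coe_add, hw, ih, Walk.length_cons, succ_nsmul]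
    abel

/-- The largest weight of a walk of length `j` starting at `u`. The supremum is junk if the weights
of these walks are unbounded or if there is no such walk. -/
noncomputable def maxWalkSum (H : SimpleGraph V) (w : V → V → ℝ) (j : ℕ) (u : V) : ℝ :=
  ⨆ p : Σ v, {p : H.Walk u v // p.length = j}, walkSum w p.2.1

theorem maxWalkSum_zero (w : V → V → ℝ) (u : V) : maxWalkSum H w 0 u = 0 := by
  have hzero : ∀ p : Σ v, {p : H.Walk u v // p.length = 0}, walkSum w p.2.1 = 0 := by
    rintro ⟨v, p, hp⟩
    cases p with
    | nil => rfl
    | cons => simp at hp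
  simp only [maxWalkSum, hzero, Real.iSup_const_zero]

theorem walkSum_le_maxWalkSum {w : V → V → ℝ} {C : ℝ} (hC : ∀ ⦃u v⦄, H.Adj u v → w u v ≤ C)
    {u v : V} (p : H.Walk u v) : walkSum w p ≤ maxWalkSum H w p.length u := by
  refine le_ciSup (f := fun q : Σ v, {q : H.Walk u v // q.length = p.length} => walkSum w q.2.1)
    ⟨p.length * C, ?_⟩ ⟨v, p, rfl⟩
  rintro _ ⟨⟨x, q, hq⟩, rfl⟩
  exact (walkSum_le_length_mul hC q).trans_eq (by rw [hq])

theorem maxWalkSum_le {w : V → V → ℝ} {j : ℕ} {u v : V} {B : ℝ} (huv : H.Adj u v)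
    (hB : ∀ x (p : H.Walk u x), p.length = j → walkSum w p ≤ B) : maxWalkSum H w j u ≤ B := by
  obtain ⟨x, p, hp⟩ := exists_walk_length_eq_of_adj huv j
  have : Nonempty (Σ v, {p : H.Walk u v // p.length = j}) := ⟨x, p, hp⟩
  exact ciSup_le fun q => hB q.1 q.2.1 q.2.2

theorem add_maxWalkSum_le_maxWalkSum_succ {w : V → V → ℝ} {C : ℝ}
    (hC : ∀ ⦃u v⦄, H.Adj u v → w u v ≤ C) {u v : V} (huv : H.Adj u v) (j : ℕ) :
    w u v + maxWalkSum H w j v ≤ maxWalkSum H w (j + 1) u := by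
  rw [← le_sub_iff_add_le']
  refine maxWalkSum_le huv.symm ?_
  rintro x p rfl
  rw [le_sub_iff_add_le', ← walkSum_cons w huv p]
  exact walkSum_le_maxWalkSum hC (.cons huv p)

theorem exists_potential_of_walkSum_le {w : V → V → ℝ} {C ε : ℝ} {n : ℕ} (hn : n ≠ 0)
    (hC : ∀ ⦃u v⦄, H.Adj u v → w u v ≤ C)
    (hε : ∀ u v (p : H.Walk u v), p.length = n → walkSum w p ≤ ε) :
    ∃ π : V → ℝ, ∀ ⦃u v⦄, H.Adj u v → w u v + π v - π u ≤ ε / n := by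
  refine ⟨fun u => (∑ j ∈ Finset.range n, maxWalkSum H w j u) / n, fun u v huv => ?_⟩
  have hn' : (0 : ℝ) < n := by exact_mod_cast Nat.pos_of_ne_zero hn
  have hsum : n * w u v + ∑ j ∈ Finset.range n, maxWalkSum H w j v ≤
      (∑ j ∈ Finset.range n, maxWalkSum H w j u) + ε :=
    calc n * w u v + ∑ j ∈ Finset.range n, maxWalkSum H w j v
        = ∑ j ∈ Finset.range n, (w u v + maxWalkSum H w j v) := by
          rw [Finset.sum_add_distrib, Finset.sum_const, Finset.card_range, nsmul_eq_mul]
      _ ≤ ∑ j ∈ Finset.range n, maxWalkSum H w (j + 1) u :=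
          Finset.sum_le_sum fun j _ => add_maxWalkSum_le_maxWalkSum_succ hC huv j
      _ = (∑ j ∈ Finset.range n, maxWalkSum H w j u) + maxWalkSum H w n u := by
          rw [← Finset.sum_range_succ, Finset.sum_range_succ', maxWalkSum_zero, add_zero]
      _ ≤ (∑ j ∈ Finset.range n, maxWalkSum H w j u) + ε := by
          gcongr
          exact maxWalkSum_le huv (hε u)
  rw [← mul_le_mul_iff_of_pos_left hn', mul_sub, mul_add]
  simp only [mul_div_cancel₀ _ hn'.ne']
  linarith

end Walks

section Power

variable {V : Type*} {H : SimpleGraph V} {ε : ℝ} {n : ℕ}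

theorem abs_walkSum_le_of_odd {w : V → V → ℝ} {ψ : V → UnitAddCircle} (hε : ε < 1 / 4)
    (hn : Odd n) (hw : ∀ u v, (w u v : UnitAddCircle) = ψ v - ψ u - halfTurn)
    (hedge : ∀ ⦃u v⦄, H.Adj u v → |w u v| ≤ ε)
    (hψ : ∀ u v (p : H.Walk u v), p.length = n → ‖ψ v - ψ u - halfTurn‖ ≤ ε) :
    ∀ {u v : V} (p : H.Walk u v), Odd p.length → p.length ≤ n → |walkSum w p| ≤ ε
  | _, _, .nil, hp, _ => by simp at hp
  | _, _, .cons h .nil, _, _ => by simpa [walkSum_cons, walkSum_nil] using hedge h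
  | u, v, .cons h (.cons h' p), hp, hpn => by
    have hodd : Odd p.length := by
      simpa [Walk.length_cons, Nat.odd_add_one] using hp
    have ih : |walkSum w p| ≤ ε :=
      abs_walkSum_le_of_odd hε hn hw hedge hψ p hodd (by simp at hpn; omega)
    have hthree : |walkSum w (.cons h (.cons h' p))| ≤ ε + (ε + ε) := by
      rw [walkSum_cons, walkSum_cons]
      exact (abs_add_le _ _).trans <| add_le_add (hedge h) <|
        (abs_add_le _ _).trans <| add_le_add (hedge h') ih
    obtain ⟨q, hq⟩ := exists_walk_length_eq_of_odd _ hp hn hpn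
    obtain ⟨t, ht, ht_abs⟩ := exists_coe_eq_and_abs_eq_norm (ψ v - ψ u - halfTurn)
    have htε : |t| ≤ ε := ht_abs.trans_le (hψ u v q hq)
    -- The two lifts of `ψ v - ψ u - halfTurn` differ by an integer of size at most `4 * ε < 1`.
    have hlift : walkSum w (.cons h (.cons h' p)) = t := by
      refine eq_of_coe_eq_coe_of_abs_sub_lt_one ?_ ?_
      · rw [coe_walkSum hw, nsmul_halfTurn_of_odd hp, ht]
      · linarith [abs_sub (walkSum w (.cons h (.cons h' p))) t]
    rwa [hlift]

theorem AntipodalColorable.of_power (h : AntipodalColorable (FracPow.power H n) ε) (hn : Odd n)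
    (hε : ε < 1 / 4) (hclosed : ∀ u (p : H.Walk u u), p.length ≠ n) :
    AntipodalColorable H (ε / n) := by
  obtain ⟨ψ, hψ⟩ := h
  have hwalk : ∀ u v (p : H.Walk u v), p.length = n → ‖ψ v - ψ u - halfTurn‖ ≤ ε := by
    refine fun u v p hp => hψ ⟨?_, p, hp⟩
    rintro rfl
    exact hclosed u p hp
  choose lift coe_lift abs_lift using exists_coe_eq_and_abs_eq_norm
  let w : V → V → ℝ := fun u v => lift (ψ v - ψ u - halfTurn)
  have hw : ∀ u v, (w u v : UnitAddCircle) = ψ v - ψ u - halfTurn := fun u v => coe_lift _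
  have hedge : ∀ ⦃u v⦄, H.Adj u v → |w u v| ≤ ε := fun u v huv => by
    obtain ⟨q, hq⟩ := exists_walk_length_eq_of_odd (.cons huv .nil) odd_one hn hn.pos
    exact (abs_lift _).trans_le (hwalk u v q hq)
  have hanti : ∀ ⦃u v⦄, H.Adj u v → w v u = -w u v := fun u v huv => by
    refine eq_of_coe_eq_coe_of_abs_sub_lt_one ?_ ?_
    · rw [AddCircle.coe_neg, hw, hw, sub_eq_add_neg (ψ u - ψ v), neg_halfTurn]
      abel
    · rw [sub_neg_eq_add]
      linarith [abs_add_le (w v u) (w u v), hedge huv, hedge huv.symm]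
  obtain ⟨π, hπ⟩ := exists_potential_of_walkSum_le (H := H) hn.pos.ne'
    (fun u v huv => (le_abs_self _).trans (hedge huv)) fun u v p hp =>
      (le_abs_self _).trans (abs_walkSum_le_of_odd hε hn hw hedge hwalk p (hp ▸ hn) hp.le)
  refine ⟨fun v => ψ v + (π v : UnitAddCircle), fun u v huv => ?_⟩
  have hshift : ψ v + (π v : UnitAddCircle) - (ψ u + (π u : UnitAddCircle)) - halfTurn =
      (w u v + π v - π u : ℝ) := by
    rw [AddCircle.coe_sub, AddCircle.coe_add, hw]
    abel
  rw [hshift]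
  refine QuotientAddGroup.norm_mk_le_norm.trans (abs_le.2 ⟨?_, hπ huv⟩)
  linarith [hπ huv.symm, hanti huv]

end Power

section Subdivision

variable {V : Type*} {G : SimpleGraph V} {δ : ℝ} {q : ℕ}

theorem adj_out (e : G.edgeSet) : G.Adj (Quot.out e.1).1 (Quot.out e.1).2 := by
  have h : s((Quot.out e.1).1, (Quot.out e.1).2) = e.1 := Quot.out_eq e.1
  rw [← mem_edgeSet, h]
  exact e.2

theorem pathVertex_zero (e : G.edgeSet) : pathVertex G q e 0 = .inl (Quot.out e.1).1 := by
  rw [pathVertex, dif_pos rfl]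

theorem pathVertex_self (hq : 0 < q) (e : G.edgeSet) :
    pathVertex G q e q = .inl (Quot.out e.1).2 := by
  rw [pathVertex, dif_neg hq.ne', dif_neg (lt_irrefl q)]

theorem pathVertex_ne_succ (e : G.edgeSet) {i : ℕ} (hi : i < q) :
    pathVertex G q e i ≠ pathVertex G q e (i + 1) := by
  rw [pathVertex, pathVertex, dif_neg i.succ_ne_zero]
  split_ifs with h0 hlast hlast
  · exact Sum.inl_ne_inr
  · exact fun h => (adj_out e).ne (Sum.inl_injective h)
  · simp only [ne_eq, Sum.inr.injEq, Prod.mk.injEq, Fin.mk.injEq]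
    omega
  · exact Sum.inr_ne_inl

theorem subdivision_adj_pathVertex (e : G.edgeSet) {i : ℕ} (hi : i < q) :
    (subdivision G q).Adj (pathVertex G q e i) (pathVertex G q e (i + 1)) :=
  (fromRel_adj _ _ _).2 ⟨pathVertex_ne_succ e hi, .inl ⟨e, i, hi, rfl, rfl⟩⟩

theorem exists_walk_pathVertex (e : G.edgeSet) {i : ℕ} (hi : i ≤ q) :
    ∃ p : (subdivision G q).Walk (pathVertex G q e 0) (pathVertex G q e i), p.length = i := by
  induction i with
  | zero => exact ⟨.nil, rfl⟩
  | succ i ih =>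
    obtain ⟨p, hp⟩ := ih (by omega)
    exact ⟨p.concat (subdivision_adj_pathVertex e hi), by rw [Walk.length_concat, hp]⟩

theorem exists_walk_subdivision (hq : 0 < q) {u v : V} (huv : G.Adj u v) :
    ∃ p : (subdivision G q).Walk (.inl u) (.inl v), p.length = q := by
  let e : G.edgeSet := ⟨s(u, v), huv⟩
  obtain ⟨p, hp⟩ := exists_walk_pathVertex e (le_refl q)
  have hstart := pathVertex_zero (q := q) e
  have hend := pathVertex_self hq e
  have hout : s((Quot.out e.1).1, (Quot.out e.1).2) = s(u, v) := Quot.out_eq e.1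
  rcases Sym2.eq_iff.1 hout with ⟨hu, hv⟩ | ⟨hv, hu⟩
  · exact ⟨p.copy (hstart.trans (congrArg _ hu)) (hend.trans (congrArg _ hv)),
      by rwa [Walk.length_copy]⟩
  · exact ⟨(p.copy (hstart.trans (congrArg _ hv)) (hend.trans (congrArg _ hu))).reverse,
      by rwa [Walk.length_reverse, Walk.length_copy]⟩

theorem AntipodalColorable.of_subdivision (h : AntipodalColorable (subdivision G q) δ)
    (hq : Odd q) : AntipodalColorable G (q * δ) := by
  obtain ⟨φ, hφ⟩ := h
  refine ⟨fun v => φ (.inl v), fun u v huv => ?_⟩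
  obtain ⟨p, hp⟩ := exists_walk_subdivision hq.pos huv
  rw [← hp] at hq
  simpa only [hp] using hφ.norm_sub_sub_le_of_odd p hq

/-- The extension of an antipodal colouring `φ` of `G` to its `q`-subdivision in which every edge of
the path replacing `e` has the error `t e / q`, where `t e` lifts the error of `φ` on `e` to `ℝ`. -/
noncomputable def subdivisionColoring (φ : V → UnitAddCircle) (t : G.edgeSet → ℝ) (q : ℕ) :
    SubdivVertex G q → UnitAddCircle :=
  Sum.elim φ fun x =>
    φ (Quot.out x.1.1).1 + ((x.2 : ℕ) + 1) • (halfTurn + ((t x.1 / q : ℝ) : UnitAddCircle))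

theorem subdivisionColoring_pathVertex {φ : V → UnitAddCircle} {t : G.edgeSet → ℝ} (hq : Odd q)
    (ht : ∀ e : G.edgeSet,
      (t e : UnitAddCircle) = φ (Quot.out e.1).2 - φ (Quot.out e.1).1 - halfTurn)
    (e : G.edgeSet) {i : ℕ} (hi : i ≤ q) :
    subdivisionColoring φ t q (pathVertex G q e i) =
      φ (Quot.out e.1).1 + i • (halfTurn + ((t e / q : ℝ) : UnitAddCircle)) := by
  rcases Nat.eq_zero_or_pos i with rfl | hi0
  · rw [pathVertex_zero, subdivisionColoring, Sum.elim_inl, zero_nsmul, add_zero]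
  rcases hi.lt_or_eq with hi | rfl
  · rw [pathVertex, dif_neg hi0.ne', dif_pos hi, subdivisionColoring, Sum.elim_inr,
      Nat.sub_add_cancel hi0]
  · have hi' : (i : ℝ) ≠ 0 := by exact_mod_cast hi0.ne'
    rw [pathVertex_self hi0, subdivisionColoring, Sum.elim_inl, nsmul_add,
      nsmul_halfTurn_of_odd hq, ← AddCircle.coe_nsmul, nsmul_eq_mul, mul_div_cancel₀ _ hi', ht]
    abel

theorem AntipodalColorable.subdivision (h : AntipodalColorable G δ) (hq : Odd q) :
    AntipodalColorable (FracPow.subdivision G q) (δ / q) := by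
  obtain ⟨φ, hφ⟩ := h
  choose t coe_t abs_t using fun e : G.edgeSet =>
    exists_coe_eq_and_abs_eq_norm (φ (Quot.out e.1).2 - φ (Quot.out e.1).1 - halfTurn)
  have hstep : ∀ e i, i < q →
      ‖subdivisionColoring φ t q (pathVertex G q e (i + 1)) -
        subdivisionColoring φ t q (pathVertex G q e i) - halfTurn‖ ≤ δ / q := fun e i hi => by
    rw [subdivisionColoring_pathVertex hq coe_t e hi,
      subdivisionColoring_pathVertex hq coe_t e hi.le, succ_nsmul, ← add_assoc,
      add_sub_cancel_left, add_sub_cancel_left]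
    calc ‖((t e / q : ℝ) : UnitAddCircle)‖ ≤ |t e / q| := QuotientAddGroup.norm_mk_le_norm
      _ = |t e| / q := by rw [abs_div, Nat.abs_cast]
      _ ≤ δ / q := by gcongr; exact (abs_t e).trans_le (hφ (adj_out e))
  refine ⟨subdivisionColoring φ t q, fun x y hxy => ?_⟩
  obtain ⟨-, ⟨e, i, hi, rfl, rfl⟩ | ⟨e, i, hi, rfl, rfl⟩⟩ := (fromRel_adj _ _ _).1 hxy
  · exact hstep e i hi
  · rw [norm_sub_sub_halfTurn_comm]
    exact hstep e i hi

end Subdivision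

section FractionalPower

variable {V : Type*} {G : SimpleGraph V} {p q : ℕ} {δ : ℝ}

theorem AntipodalColorable.fracPower (h : AntipodalColorable G δ) (hp : Odd p) (hq : Odd q) :
    AntipodalColorable (FracPow.fracPower G p q) (p * (δ / q)) :=
  (h.subdivision hq).power hp

theorem AntipodalColorable.of_fracPower (h : AntipodalColorable (FracPow.fracPower G p q) δ)
    (hp : Odd p) (hq : Odd q) (hδ : δ < 1 / 4)
    (hG : (p : ℝ) / q * (1 / 2 - 1 / circularChromaticNumber G) < 1 / 2) :
    AntipodalColorable G (q * (δ / p)) := by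
  have hp' : (0 : ℝ) < p := by exact_mod_cast hp.pos
  have hq' : (0 : ℝ) < q := by exact_mod_cast hq.pos
  obtain ⟨η, hη, hη2⟩ : ∃ η, 1 / 2 - 1 / circularChromaticNumber G < η ∧ p * (η / q) < 1 / 2 := by
    obtain ⟨η, hη, hη2⟩ := exists_between ((lt_div_iff₀' (div_pos hp' hq')).2 hG)
    rw [lt_div_iff₀' (div_pos hp' hq')] at hη2
    exact ⟨η, hη, by rwa [mul_div_left_comm, mul_comm]⟩
  refine (AntipodalColorable.of_power h hp hδ fun u w hw => ?_).of_subdivision hq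
  have := ((antipodalColorable_of_lt hη).subdivision hq).half_le_length_mul w (hw ▸ hp)
  rw [hw] at this
  exact hη2.not_ge this

theorem half_sub_one_div_fracPower_le (G : SimpleGraph V) (hp : Odd p) (hq : Odd q) :
    1 / 2 - 1 / circularChromaticNumber (fracPower G p q) ≤
      (p : ℝ) / q * (1 / 2 - 1 / circularChromaticNumber G) := by
  have hp' : (0 : ℝ) < p := by exact_mod_cast hp.pos
  have hq' : (0 : ℝ) < q := by exact_mod_cast hq.pos
  have hG := one_div_circularChromaticNumber_le_half G
  refine le_of_forall_gt_imp_ge_of_dense fun ε hε => ?_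
  have hε0 : 0 ≤ ε := (mul_nonneg (by positivity) (by linarith)).trans hε.le
  rw [← lt_div_iff₀' (div_pos hp' hq')] at hε
  have hcol := (antipodalColorable_of_lt hε).fracPower hp hq
  rw [show p * (ε / (p / q) / q) = ε by field_simp] at hcol
  exact hcol.half_sub_one_div_le hε0

theorem le_half_sub_one_div_fracPower (G : SimpleGraph V) (hp : Odd p) (hq : Odd q)
    (h : (p : ℝ) / q * (1 / 2 - 1 / circularChromaticNumber G) < 1 / 4) :
    (p : ℝ) / q * (1 / 2 - 1 / circularChromaticNumber G) ≤
      1 / 2 - 1 / circularChromaticNumber (fracPower G p q) := by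
  have hp' : (0 : ℝ) < p := by exact_mod_cast hp.pos
  have hq' : (0 : ℝ) < q := by exact_mod_cast hq.pos
  have hpow := one_div_circularChromaticNumber_le_half (fracPower G p q)
  by_contra! hlt
  obtain ⟨δ, hpowδ, hδ⟩ := exists_between hlt
  have hδ0 : 0 ≤ δ := by linarith
  have hcol : AntipodalColorable G (q * (δ / p)) :=
    (antipodalColorable_of_lt hpowδ).of_fracPower hp hq (by linarith) (by linarith)
  have hle := hcol.half_sub_one_div_le (by positivity)
  rw [← div_lt_iff₀' (div_pos hp' hq'), div_div_eq_mul_div, mul_comm, mul_div_assoc] at hδ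
  exact hδ.not_ge hle

theorem one_div_circularChromaticNumber_fracPower (G : SimpleGraph V) (hp : Odd p) (hq : Odd q)
    (h : (p : ℝ) / q * (1 / 2 - 1 / circularChromaticNumber G) < 1 / 4) :
    1 / circularChromaticNumber (fracPower G p q) =
      1 / 2 - (p : ℝ) / q * (1 / 2 - 1 / circularChromaticNumber G) := by
  linarith [le_half_sub_one_div_fracPower G hp hq h, half_sub_one_div_fracPower_le G hp hq]

end FractionalPower

theorem two_mul_mul_sub_two_lt_of_le_div {a b x : ℝ} (hb : 0 < b) (hx : 2 ≤ x)
    (h : a / b ≤ x / (3 * (x - 2))) : 2 * a * (x - 2) < b * x := by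
  have hle : a / b * (3 * (x - 2)) ≤ x := mul_le_of_le_div₀ (by linarith) (by linarith) h
  rw [div_mul_eq_mul_div, div_le_iff₀ hb] at hle
  nlinarith [mul_pos hb (show 0 < x by linarith)]

end FracPow

theorem mainTheorem2_general {V : Type*} (G : SimpleGraph V) {n : ℕ} (hG : G.Colorable n) (r s : ℕ)
    (h : 2 * (2 * (r : ℝ) + 1) * (FracPow.circularChromaticNumber G - 2) <
      (2 * (s : ℝ) + 1) * FracPow.circularChromaticNumber G) :
    FracPow.circularChromaticNumber (FracPow.fracPower G (2 * r + 1) (2 * s + 1)) =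
      (2 * (s : ℝ) + 1) * FracPow.circularChromaticNumber G /
        (((s : ℝ) - (r : ℝ)) * FracPow.circularChromaticNumber G + 2 * (r : ℝ) + 1) := by
  have hχ := FracPow.two_le_circularChromaticNumber hG
  have key := FracPow.one_div_circularChromaticNumber_fracPower G
    (odd_two_mul_add_one r) (odd_two_mul_add_one s)
  set χ := FracPow.circularChromaticNumber G
  have hχ0 : 0 < χ := by linarith
  push_cast at key
  have hsmall : (2 * (r : ℝ) + 1) / (2 * s + 1) * (1 / 2 - 1 / χ) < 1 / 4 := by
    rw [div_sub_div _ _ two_ne_zero hχ0.ne', div_mul_div_comm,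
      div_lt_div_iff₀ (by positivity) (by norm_num)]
    linarith
  have hinv : 1 / 2 - (2 * (r : ℝ) + 1) / (2 * s + 1) * (1 / 2 - 1 / χ) =
      ((s - r) * χ + 2 * r + 1) / ((2 * s + 1) * χ) := by
    field_simp
    ring
  rw [← one_div_one_div (FracPow.circularChromaticNumber _), key hsmall, hinv, one_div_div]

theorem mainTheorem2 {V : Type*} [Finite V] (G : SimpleGraph V) (hG : ¬ G.IsBipartite) (r s : ℕ)
    (h : (2 * (r : ℝ) + 1) / (2 * (s : ℝ) + 1) ≤
      FracPow.circularChromaticNumber G / (3 * (FracPow.circularChromaticNumber G - 2))) :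
    FracPow.circularChromaticNumber (FracPow.fracPower G (2 * r + 1) (2 * s + 1)) =
      (2 * (s : ℝ) + 1) * FracPow.circularChromaticNumber G /
        (((s : ℝ) - (r : ℝ)) * FracPow.circularChromaticNumber G + 2 * (r : ℝ) + 1) := by
  have := Fintype.ofFinite V
  have hχ := FracPow.two_le_circularChromaticNumber G.colorable_of_fintype
  exact mainTheorem2_general G G.colorable_of_fintype r s
    (FracPow.two_mul_mul_sub_two_lt_of_le_div (by positivity) hχ h)
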